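/- Setting. A BPA system is $\Delta=(\mathcal V,\mathcal A,\mathcal R)$ with a finite set $\mathcal V$ of variables, a finite set $\mathcal A$ of actions (one possible action is the internal action $\tau$; the others are visible) and a finite set $\mathcal R$ of rules $X\xrightarrow{\lambda}\rho$ with $X\in\mathcal V$, $\lambda\in\mathcal A$, $\rho\in\mathcal V^*$. A process is a word in $\mathcal V^*$, and $X\beta\xrightarrow{\lambda}\rho\beta$ for every rule $X\xrightarrow{\lambda}\rho$ and every $\beta\in\mathcal V^*$. Write $\Rightarrow$ for the reflexive transitive closure of $\xrightarrow{\tau}$. The system is normed if every variable can reach the empty word $\epsilon$ by some sequence of transitions. A symmetric relation $S$ on processes is a branching bisimulation if, whenever $\alpha\,S\,\beta$ and $\alpha\xrightarrow{\lambda}\alpha'$, either $\lambda=\tau$ and $\alpha'\,S\,\beta$, or $\beta\Rightarrow\beta''\xrightarrow{\lambda}\beta'$ for some $\beta'',\beta'$ with $\alpha\,S\,\beta''$ and $\alpha'\,S\,\beta'$. Branching bisimilarity $\simeq$ is the largest branching bisimulation (processes of different systems are compared in the disjoint union of their transition systems). A process is regular w.r.t. $\simeq$ if it is branching bisimilar to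 some process, possibly of another BPA system, from which only finitely many processes are reachable. Let $\Delta$ be a normed BPA system. The redundant set of $\alpha$ is $\mathrm{Rd}(\alpha)=\{X\in\mathcal V : X\alpha\simeq\alpha\}$. The relative branching norm $\|\alpha\|^{\beta}$ is the least $k$ for which there is a sequence $$\alpha\beta\Rightarrow\alpha_1'\beta\to\alpha_1\beta\Rightarrow\alpha_2'\beta\to\alpha_2\beta\Rightarrow\cdots\to\alpha_k\beta\Rightarrow\beta$$ in which the two ends of each $\Rightarrow$ are branching bisimilar and each $\to$ is either a visible transition or a $\tau$-transition between processes that are not branching bisimilar. Both $\mathrm{Rd}(\delta\gamma)$ and $\|\delta\|^{\gamma}$ depend on $\gamma$ only through $\mathrm{Rd}(\gamma)$. The weighted directed graph $G(\Delta)$ has as nodes the pairs $(X,R)$ with $X\in\mathcal V$, $R\subseteq\mathcal V^0$ and $R=\mathrm{Rd}(\alpha)$ for some process $\alpha$, where $\mathcal V^0$ is the set of variables $X$ with $X\Rightarrow\epsilon$. There is an edge from $(X_1,R_1)$ to $(X_2,R_2)$ iff there are a rule $X_1\xrightarrow{\lambda}\sigma X_2\delta$ and a process $\gamma$ with $\mathrm{Rd}(\gamma)=R_1$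 and $\mathrm{Rd}(\delta\gamma)=R_2$; its weight is $1$ if these can be chosen with $\|\delta\|^{\gamma}>0$, and $0$ otherwise. A witness path for a non-empty process $X\alpha$ is a path $p_0\xrightarrow{u_1}p_1\xrightarrow{u_2}\cdots\xrightarrow{u_k}p_k$ in $G(\Delta)$ (with $u_j$ the weight of the $j$-th edge) such that $p_0=(X,\mathrm{Rd}(\alpha))$ and, for some $0\le i<k$, $p_i=p_k$ and $\sum_{j=i+1}^{k}u_j>0$. Lemma. Let $\Delta$ be a normed BPA system and let $X_1X_2\cdots X_k$ ($k\ge 0$) be a process of $\Delta$. Then $X_1X_2\cdots X_k$ is not regular w.r.t. branching bisimilarity if and only if there are $1\le i\le k$ and a witness path in $G(\Delta)$ for $X_iX_{i+1}\cdots X_k$. -/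

import Mathlib

universe u v

/-- A BPA system with set of variables `V`. Actions are elements of `Option L`: `none` is the
internal action `τ`, and `some a` is a visible action. A rule `(X, l, ρ)` stands for `X -l-> ρ`. -/
structure BPA (V : Type u) (L : Type v) where
  finite_vars : Finite V
  actions : Set (Option L)
  finite_actions : actions.Finite
  rules : Set (V × Option L × List V)
  finite_rules : rules.Finite
  action_mem : ∀ {X : V} {l : Option L} {ρ : List V}, (X, l, ρ) ∈ rules → l ∈ actions

/-! ### Branching bisimilarity on a labelled transition system -/

/-- `s ⇒ t`: the reflexive transitive closure of internal transitions. -/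
def TauStar {S : Type u} {L : Type v} (T : S → Option L → S → Prop) : S → S → Prop :=
  Relation.ReflTransGen (fun s t => T s none t)

/-- Branching bisimulations of a labelled transition system. -/
def IsBranchingBisimulation {S : Type u} {L : Type v} (T : S → Option L → S → Prop)
    (R : S → S → Prop) : Prop :=
  (∀ s t, R s t → R t s) ∧
  ∀ s t, R s t → ∀ l s', T s l s' →
    (l = none ∧ R s' t) ∨
    ∃ t'' t', TauStar T t t'' ∧ T t'' l t' ∧ R s t'' ∧ R s' t'

/-- Branching bisimilarity: the union of all branching bisimulations. -/
def BranchingBisimilar {S : Type u} {L : Type v} (T : S → Option L → S → Prop) (s t : S) : Prop :=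
  ∃ R : S → S → Prop, IsBranchingBisimulation T R ∧ R s t

/-- The disjoint union of two labelled transition systems over the same actions. It is used to
compare states of different systems. -/
inductive SumTrans {S : Type u} {S' : Type v} {A : Type*} (T : S → A → S → Prop)
    (T' : S' → A → S' → Prop) : S ⊕ S' → A → S ⊕ S' → Prop
  | left {s t : S} {l : A} (h : T s l t) : SumTrans T T' (Sum.inl s) l (Sum.inl t)
  | right {s t : S'} {l : A} (h : T' s l t) : SumTrans T T' (Sum.inr s) l (Sum.inr t)

namespace BPA

variable {V : Type u} {L : Type v} (Δ : BPA V L)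

/-- The transitions between processes (words over `V`): a rule is applied to the leftmost
variable, and the rest of the word is kept. -/
inductive Step : List V → Option L → List V → Prop
  | intro {X : V} {l : Option L} {ρ : List V} (h : (X, l, ρ) ∈ Δ.rules) (β : List V) :
      Step (X :: β) l (ρ ++ β)

/-- Reachability by arbitrary sequences of actions. -/
def Reaches : List V → List V → Prop :=
  Relation.ReflTransGen (fun α β => ∃ l, Δ.Step α l β)

/-- A system is normed if every variable can reach the empty process. -/
def IsNormed : Prop := ∀ X : V, Δ.Reaches [X] []

/-- Branching bisimilarity of two processes of `Δ`. -/
def Beq (α β : List V) : Prop := BranchingBisimilar Δ.Step α β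

/-- A process is finite-state if only finitely many processes are reachable from it. -/
def IsFiniteState (α : List V) : Prop := {β | Δ.Reaches α β}.Finite

/-- A process is regular with respect to branching bisimilarity if it is branching bisimilar to
some finite-state process of some (possibly different, possibly not normed) BPA system. -/
def IsRegular (α : List V) : Prop :=
  ∃ (W : Type) (Θ : BPA W L) (γ : List W),
    Θ.IsFiniteState γ ∧ BranchingBisimilar (SumTrans Δ.Step Θ.Step) (Sum.inl α) (Sum.inr γ)

/-- The redundant set of `α`. -/
def Rd (α : List V) : Set V := {X | Δ.Beq (X :: α) α}

/-! ### The relative branching norm -/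

/-- `α ⇒ β` by internal actions, with `α` and `β` branching bisimilar. -/
def InertStar (α β : List V) : Prop := TauStar Δ.Step α β ∧ Δ.Beq α β

/-- A visible action, or an internal action that changes the bisimilarity class. -/
def Jump (α β : List V) : Prop :=
  (∃ a : L, Δ.Step α (some a) β) ∨ (Δ.Step α none β ∧ ¬ Δ.Beq α β)

/-- `NormPath β α k`: there is a sequence `αβ ⇒ α₁'β -> α₁β ⇒ α₂'β -> ⋯ -> α_kβ ⇒ β` with
exactly `k` jumps, in which each `⇒` is inert. -/
inductive NormPath (β : List V) : List V → ℕ → Prop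
  | zero {α : List V} (h : Δ.InertStar (α ++ β) β) : NormPath β α 0
  | succ {α α' α'' : List V} {k : ℕ} (h : Δ.InertStar (α ++ β) (α' ++ β))
      (hj : Δ.Jump (α' ++ β) (α'' ++ β)) (hp : NormPath β α'' k) : NormPath β α (k + 1)

/-- The branching norm of `α` relative to `β`. In a normed system the set is never empty. -/
noncomputable def relNorm (α β : List V) : ℕ := sInf {k | Δ.NormPath β α k}

/-! ### The weighted graph `G(Δ)` -/

/-- The variables that can reach the empty process by internal actions alone. -/
def V0 : Set V := {X | TauStar Δ.Step [X] []}

/-- The nodes of the graph. -/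
def nodes : Set (V × Set V) := {p | p.2 ⊆ Δ.V0 ∧ ∃ α, Δ.Rd α = p.2}

/-- `EdgeVia p q δ γ`: for `p = (X₁, R₁)` and `q = (X₂, R₂)`, there is a rule `X₁ -l-> σ X₂ δ`,
and `γ` is a process with redundant set `R₁` such that `δγ` has redundant set `R₂`. -/
def EdgeVia (p q : V × Set V) (δ γ : List V) : Prop :=
  (∃ (l : Option L) (σ : List V), (p.1, l, σ ++ q.1 :: δ) ∈ Δ.rules) ∧
    Δ.Rd γ = p.2 ∧ Δ.Rd (δ ++ γ) = q.2

/-- The edges of the graph. In a normed system the redundant set of `δγ` depends on `γ` only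
through the redundant set of `γ`, so the choice of the representative `γ` is immaterial. -/
def Edge (p q : V × Set V) : Prop :=
  p ∈ Δ.nodes ∧ q ∈ Δ.nodes ∧ ∃ δ γ, Δ.EdgeVia p q δ γ

open Classical in
/-- The weight of an edge: `1` if it comes from some `δ` of positive branching norm relative to
(a process whose redundant set is) `R₁`, and `0` otherwise. -/
noncomputable def weight (p q : V × Set V) : ℕ :=
  if ∃ δ γ, Δ.EdgeVia p q δ γ ∧ 0 < Δ.relNorm δ γ then 1 else 0

/-- There is a witness path for `Xα`: a path `p₀, p₁, …, p_k` of the graph that starts in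
`(X, Rd α)` and such that, for some `i < k`, `p_i = p_k` and the part of the path from
`p_i` to `p_k` has positive total weight. -/
def HasWitnessPath (X : V) (α : List V) : Prop :=
  ∃ (k : ℕ) (p : ℕ → V × Set V), p 0 = (X, Δ.Rd α) ∧
    (∀ j < k, Δ.Edge (p j) (p (j + 1))) ∧
    ∃ i < k, p i = p k ∧ 0 < ∑ j ∈ Finset.Ico i k, Δ.weight (p j) (p (j + 1))

end BPA

/-! A process is regular iff the processes reachable from it form finitely many bisimilarity classes
(`isRegular_iff`), so the task is to decide when this number is infinite. The measure is
`branchingNorm`, which need not count inert steps. It is invariant under bisimilarity, it does not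
decrease when a word is put in front, and it stays the same from `γ` to `δ ++ γ` only if these two
are bisimilar. Also, how words behave on top of `γ` depends only on `Rd γ`
(`IsNormed.beq_append_of_rd_eq`), so a path of the graph can be followed over any stack with the
right redundant set. A positive cycle can therefore be run again and again, and each round raises
the norm of the stack: infinitely many classes arise. If there is no such cycle, each step that
changes the stack up to bisimilarity follows an edge that cannot be undone in the finite graph. This
happens boundedly often and adds boundedly many letters each time (`Tracked.exists_beq`). Induction
on the word then gives finitely many classes. -/

section Bisimilarity

/-! ### Branching bisimilarity: equivalence, stuttering and transfer. -/

variable {S : Type*} {L : Type*} {T : S → Option L → S → Prop}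

/-- Semi-branching bisimulations: an internal move may also be answered by internal moves to a
state related to both ends. Unlike branching bisimulations, they are closed under composition. -/
def IsSemiBranching (T : S → Option L → S → Prop) (R : S → S → Prop) : Prop :=
  (∀ s t, R s t → R t s) ∧
  ∀ s t, R s t → ∀ l s', T s l s' →
    (l = none ∧ ∃ t', TauStar T t t' ∧ R s t' ∧ R s' t') ∨
    ∃ t'' t', TauStar T t t'' ∧ T t'' l t' ∧ R s t'' ∧ R s' t'

/-- The union of all semi-branching bisimulations. -/
def SemiBisimilar (T : S → Option L → S → Prop) (s t : S) : Prop :=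
  ∃ R : S → S → Prop, IsSemiBranching T R ∧ R s t

theorem semiBisimilar_isSemiBranching : IsSemiBranching T (SemiBisimilar T) := by
  refine ⟨fun s t ⟨R, hR, h⟩ => ⟨R, hR, hR.1 _ _ h⟩, ?_⟩
  rintro s t ⟨R, hR, h⟩ l s' hs
  rcases hR.2 s t h l s' hs with ⟨hl, t', h1, h2, h3⟩ | ⟨t'', t', h1, h2, h3, h4⟩
  · exact Or.inl ⟨hl, t', h1, ⟨R, hR, h2⟩, ⟨R, hR, h3⟩⟩
  · exact Or.inr ⟨t'', t', h1, h2, ⟨R, hR, h3⟩, ⟨R, hR, h4⟩⟩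

theorem SemiBisimilar.refl (s : S) : SemiBisimilar T s s := by
  refine ⟨Eq, ⟨fun _ _ h => h.symm, ?_⟩, rfl⟩
  rintro s _ rfl l s' hs
  exact Or.inr ⟨s, s', Relation.ReflTransGen.refl, hs, rfl, rfl⟩

theorem SemiBisimilar.symm {s t : S} (h : SemiBisimilar T s t) : SemiBisimilar T t s :=
  semiBisimilar_isSemiBranching.1 _ _ h

theorem SemiBisimilar.exists_tauStar {s t s' : S} (h : SemiBisimilar T s t)
    (hs : TauStar T s s') : ∃ t', TauStar T t t' ∧ SemiBisimilar T s' t' := by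
  induction hs with
  | refl => exact ⟨t, Relation.ReflTransGen.refl, h⟩
  | tail _ hbc ih =>
    obtain ⟨t1, ht1, h1⟩ := ih
    rcases semiBisimilar_isSemiBranching.2 _ _ h1 _ _ hbc with
      ⟨-, t2, h2, -, h3⟩ | ⟨t2, t3, h2, h3, -, h4⟩
    · exact ⟨t2, ht1.trans h2, h3⟩
    · exact ⟨t3, (ht1.trans h2).tail h3, h4⟩

theorem SemiBisimilar.trans {s t u : S} (h : SemiBisimilar T s t) (h' : SemiBisimilar T t u) :
    SemiBisimilar T s u := by
  refine ⟨fun a c => ∃ b, SemiBisimilar T a b ∧ SemiBisimilar T b c, ⟨?_, ?_⟩, t, h, h'⟩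
  · rintro a c ⟨b, h1, h2⟩
    exact ⟨b, h2.symm, h1.symm⟩
  · rintro a c ⟨b, h1, h2⟩ l a' ha
    rcases semiBisimilar_isSemiBranching.2 _ _ h1 _ _ ha with
      ⟨hl, b1, h3, h4, h5⟩ | ⟨b1, b2, h3, h4, h5, h6⟩
    · obtain ⟨c1, hc1, hbc⟩ := h2.exists_tauStar h3
      exact Or.inl ⟨hl, c1, hc1, ⟨b1, h4, hbc⟩, ⟨b1, h5, hbc⟩⟩
    · obtain ⟨c1, hc1, hbc⟩ := h2.exists_tauStar h3
      rcases semiBisimilar_isSemiBranching.2 _ _ hbc _ _ h4 with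
        ⟨hl, c2, h7, h8, h9⟩ | ⟨c2, c3, h7, h8, h9, h10⟩
      · exact Or.inl ⟨hl, c2, hc1.trans h7, ⟨b1, h5, h8⟩, ⟨b2, h6, h9⟩⟩
      · exact Or.inr ⟨c2, c3, hc1.trans h7, h8, ⟨b1, h5, h9⟩, ⟨b2, h6, h10⟩⟩

/-- Adding to the relation all pairs whose second state lies on an internal path from the first to a
state bisimilar to it is harmless: the middle state answers by moving on to the end of the path, and
the first state answers by moving to the middle. -/
theorem SemiBisimilar.stuttering {s t u : S} (h : SemiBisimilar T s u) (hst : TauStar T s t)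
    (htu : TauStar T t u) : SemiBisimilar T s t := by
  refine ⟨fun a b => SemiBisimilar T a b ∨
      ∃ v, SemiBisimilar T a v ∧ TauStar T a b ∧ TauStar T b v ∨
        SemiBisimilar T b v ∧ TauStar T b a ∧ TauStar T a v,
    ⟨?_, ?_⟩, Or.inr ⟨u, Or.inl ⟨h, hst, htu⟩⟩⟩
  · rintro a b (h | ⟨v, h⟩)
    · exact Or.inl h.symm
    · exact Or.inr ⟨v, h.symm⟩
  · have key : ∀ a b c, SemiBisimilar T a b → TauStar T c b → ∀ l a', T a l a' →
        (l = none ∧ ∃ t', TauStar T c t' ∧ SemiBisimilar T a t' ∧ SemiBisimilar T a' t') ∨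
        ∃ t'' t', TauStar T c t'' ∧ T t'' l t' ∧ SemiBisimilar T a t'' ∧
          SemiBisimilar T a' t' := by
      intro a b c hab hcb l a' ha
      rcases semiBisimilar_isSemiBranching.2 _ _ hab _ _ ha with
        ⟨hl, b1, h3, h4, h5⟩ | ⟨b1, b2, h3, h4, h5, h6⟩
      · exact Or.inl ⟨hl, b1, hcb.trans h3, h4, h5⟩
      · exact Or.inr ⟨b1, b2, hcb.trans h3, h4, h5, h6⟩
    rintro a b (hab | ⟨v, ⟨hav, -, hbv⟩ | ⟨-, hba, -⟩⟩) l a' ha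
    · exact (key a b b hab Relation.ReflTransGen.refl l a' ha).imp
        (fun ⟨hl, t', h1, h2, h3⟩ => ⟨hl, t', h1, Or.inl h2, Or.inl h3⟩)
        fun ⟨t'', t', h1, h2, h3, h4⟩ => ⟨t'', t', h1, h2, Or.inl h3, Or.inl h4⟩
    · exact (key a v b hav hbv l a' ha).imp
        (fun ⟨hl, t', h1, h2, h3⟩ => ⟨hl, t', h1, Or.inl h2, Or.inl h3⟩)
        fun ⟨t'', t', h1, h2, h3, h4⟩ => ⟨t'', t', h1, h2, Or.inl h3, Or.inl h4⟩
    · exact Or.inr ⟨a, a', hba, ha, Or.inl (SemiBisimilar.refl a),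
        Or.inl (SemiBisimilar.refl a')⟩

theorem branchingBisimilar_iff_semiBisimilar {s t : S} :
    BranchingBisimilar T s t ↔ SemiBisimilar T s t := by
  constructor
  · rintro ⟨R, hR, h⟩
    refine ⟨R, ⟨hR.1, ?_⟩, h⟩
    intro s t hst l s' hs
    rcases hR.2 s t hst l s' hs with ⟨hl, h1⟩ | h1
    · exact Or.inl ⟨hl, t, Relation.ReflTransGen.refl, hst, h1⟩
    · exact Or.inr h1
  · intro h
    refine ⟨SemiBisimilar T, ⟨semiBisimilar_isSemiBranching.1, ?_⟩, h⟩
    intro s t hst l s' hs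
    rcases semiBisimilar_isSemiBranching.2 s t hst l s' hs with ⟨rfl, t', h1, h2, h3⟩ | h1
    · rcases Relation.ReflTransGen.cases_tail h1 with rfl | ⟨c, hc, hct⟩
      · exact Or.inl ⟨rfl, h3⟩
      · exact Or.inr ⟨c, t', hc, hct,
          hst.trans ((hst.symm.trans h2).stuttering hc (Relation.ReflTransGen.single hct)), h3⟩
    · exact Or.inr h1

namespace BranchingBisimilar

theorem refl (s : S) : BranchingBisimilar T s s :=
  branchingBisimilar_iff_semiBisimilar.2 (SemiBisimilar.refl s)

theorem symm {s t : S} (h : BranchingBisimilar T s t) : BranchingBisimilar T t s :=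
  branchingBisimilar_iff_semiBisimilar.2 (branchingBisimilar_iff_semiBisimilar.1 h).symm

theorem trans {s t u : S} (h : BranchingBisimilar T s t) (h' : BranchingBisimilar T t u) :
    BranchingBisimilar T s u :=
  branchingBisimilar_iff_semiBisimilar.2 <|
    (branchingBisimilar_iff_semiBisimilar.1 h).trans (branchingBisimilar_iff_semiBisimilar.1 h')

theorem stuttering {s t u : S} (h : BranchingBisimilar T s u) (hst : TauStar T s t)
    (htu : TauStar T t u) : BranchingBisimilar T s t :=
  branchingBisimilar_iff_semiBisimilar.2 <|
    (branchingBisimilar_iff_semiBisimilar.1 h).stuttering hst htu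

/-- The transfer property of branching bisimilarity. -/
theorem transfer {s t : S} (h : BranchingBisimilar T s t) {l : Option L} {s' : S}
    (hs : T s l s') :
    (l = none ∧ BranchingBisimilar T s' t) ∨
    ∃ t'' t', TauStar T t t'' ∧ T t'' l t' ∧ BranchingBisimilar T s t'' ∧
      BranchingBisimilar T s' t' := by
  obtain ⟨R, hR, h⟩ := h
  rcases hR.2 s t h l s' hs with ⟨hl, h1⟩ | ⟨t'', t', h1, h2, h3, h4⟩
  · exact Or.inl ⟨hl, R, hR, h1⟩
  · exact Or.inr ⟨t'', t', h1, h2, ⟨R, hR, h3⟩, ⟨R, hR, h4⟩⟩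

/-- If two bisimilar states are joined by internal steps, all of these steps are inert. -/
theorem inert_of_tauStar {s t : S} (h : BranchingBisimilar T s t) (hst : TauStar T s t) :
    Relation.ReflTransGen (fun a b => T a none b ∧ BranchingBisimilar T a b) s t := by
  induction hst using Relation.ReflTransGen.head_induction_on with
  | refl => exact Relation.ReflTransGen.refl
  | head hab hbt ih =>
    have hb := h.stuttering (Relation.ReflTransGen.single hab) hbt
    exact Relation.ReflTransGen.head ⟨hab, hb⟩ (ih (hb.symm.trans h))

/-- A bisimilar state can match every reachable state. -/
theorem exists_reach {s t s' : S} (h : BranchingBisimilar T s t)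
    (hs : Relation.ReflTransGen (fun a b => ∃ l, T a l b) s s') :
    ∃ t', Relation.ReflTransGen (fun a b => ∃ l, T a l b) t t' ∧
      BranchingBisimilar T s' t' := by
  induction hs with
  | refl => exact ⟨t, Relation.ReflTransGen.refl, h⟩
  | tail _ hbc ih =>
    obtain ⟨t1, ht1, h1⟩ := ih
    obtain ⟨l, hl⟩ := hbc
    rcases h1.transfer hl with ⟨-, h2⟩ | ⟨t2, t3, h2, h3, -, h4⟩
    · exact ⟨t1, ht1, h2⟩
    · have h2' : Relation.ReflTransGen (fun a b => ∃ l, T a l b) t1 t2 :=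
        Relation.ReflTransGen.mono (fun _ _ h => ⟨_, h⟩) _ _ h2
      exact ⟨t3, (ht1.trans h2').tail ⟨_, h3⟩, h4⟩

end BranchingBisimilar

/-! ### Comparison across a disjoint union. -/

section Sum

variable {S' : Type*} {T' : S' → Option L → S' → Prop}

theorem SumTrans.tauStar_inl {s : S} {x : S ⊕ S'} (h : TauStar (SumTrans T T') (Sum.inl s) x) :
    ∃ t, x = Sum.inl t ∧ TauStar T s t := by
  induction h with
  | refl => exact ⟨s, rfl, Relation.ReflTransGen.refl⟩
  | tail _ hbc ih =>
    obtain ⟨t, rfl, ht⟩ := ih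
    cases hbc with
    | left h => exact ⟨_, rfl, ht.tail h⟩

theorem SumTrans.reach_inr {s : S'} {x : S ⊕ S'}
    (h : Relation.ReflTransGen (fun a b => ∃ l, SumTrans T T' a l b) (Sum.inr s) x) :
    ∃ t, x = Sum.inr t ∧ Relation.ReflTransGen (fun a b => ∃ l, T' a l b) s t := by
  induction h with
  | refl => exact ⟨s, rfl, Relation.ReflTransGen.refl⟩
  | tail _ hbc ih =>
    obtain ⟨t, rfl, ht⟩ := ih
    obtain ⟨l, hl⟩ := hbc
    cases hl with
    | right h => exact ⟨_, rfl, ht.tail ⟨l, h⟩⟩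

theorem BranchingBisimilar.of_inl {s t : S}
    (h : BranchingBisimilar (SumTrans T T') (Sum.inl s) (Sum.inl t)) :
    BranchingBisimilar T s t := by
  refine ⟨fun a b => BranchingBisimilar (SumTrans T T') (Sum.inl a) (Sum.inl b),
    ⟨fun _ _ h => h.symm, ?_⟩, h⟩
  intro a b hab l a' ha
  rcases hab.transfer (SumTrans.left ha) with ⟨hl, h1⟩ | ⟨t'', t', h1, h2, h3, h4⟩
  · exact Or.inl ⟨hl, h1⟩
  · obtain ⟨u, rfl, hu⟩ := SumTrans.tauStar_inl h1
    cases h2 with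
    | left h => exact Or.inr ⟨u, _, hu, h, h3, h4⟩

end Sum

end Bisimilarity

namespace BPA

variable {V : Type*} {L : Type*} {Δ : BPA V L}

/-! ### Words and left congruence. -/

section Words

theorem Reaches.append {α β : List V} (h : Δ.Reaches α β) (γ : List V) :
    Δ.Reaches (α ++ γ) (β ++ γ) := by
  induction h with
  | refl => exact Relation.ReflTransGen.refl
  | tail _ hbc ih =>
    obtain ⟨l, ⟨h, β⟩⟩ := hbc
    refine ih.tail ⟨l, ?_⟩
    simpa using Step.intro h (β ++ γ)

theorem IsNormed.reaches_nil (hΔ : Δ.IsNormed) : ∀ α : List V, Δ.Reaches α []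
  | [] => Relation.ReflTransGen.refl
  | X :: α => ((hΔ X).append α).trans (hΔ.reaches_nil α)

theorem IsNormed.reaches_append (hΔ : Δ.IsNormed) (δ γ : List V) : Δ.Reaches (δ ++ γ) γ :=
  (hΔ.reaches_nil δ).append γ

theorem tauStar_nil_of_append {δ γ : List V} (h : TauStar Δ.Step (δ ++ γ) γ) :
    TauStar Δ.Step δ [] := by
  suffices ∀ s, TauStar Δ.Step s γ → ∀ δ, s = δ ++ γ → TauStar Δ.Step δ [] from this _ h δ rfl
  intro s hs
  induction hs using Relation.ReflTransGen.head_induction_on with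
  | refl =>
    intro δ hδ
    rw [List.self_eq_append_left.1 hδ]
    exact Relation.ReflTransGen.refl
  | head hab _ ih =>
    rintro (_ | ⟨X, δ⟩) rfl
    · exact Relation.ReflTransGen.refl
    · cases hab with
      | @intro _ _ ρ h β =>
        exact Relation.ReflTransGen.head (Step.intro h δ) (ih (ρ ++ δ) (by simp))

theorem Beq.append_left {β β' : List V} (h : Δ.Beq β β') (δ : List V) :
    Δ.Beq (δ ++ β) (δ ++ β') := by
  refine ⟨fun s t => ∃ δ β β', Δ.Beq β β' ∧ s = δ ++ β ∧ t = δ ++ β', ⟨?_, ?_⟩,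
    δ, β, β', h, rfl, rfl⟩
  · rintro s t ⟨δ, β, β', h, rfl, rfl⟩
    exact ⟨δ, β', β, h.symm, rfl, rfl⟩
  · rintro s t ⟨_ | ⟨X, δ⟩, β, β', h, rfl, rfl⟩ l s' hs
    · rcases BranchingBisimilar.transfer h hs with ⟨hl, h1⟩ | ⟨t'', t', h1, h2, h3, h4⟩
      · exact Or.inl ⟨hl, [], _, _, h1, rfl, rfl⟩
      · exact Or.inr ⟨t'', t', h1, h2, ⟨[], _, _, h3, rfl, rfl⟩, ⟨[], _, _, h4, rfl, rfl⟩⟩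
    · cases hs with
      | @intro _ _ ρ hr _ =>
        exact Or.inr ⟨X :: δ ++ β', ρ ++ (δ ++ β'), Relation.ReflTransGen.refl,
          Step.intro hr (δ ++ β'), ⟨X :: δ, β, β', h, rfl, rfl⟩,
          ⟨ρ ++ δ, β, β', h, by simp, by simp⟩⟩

theorem InertStar.trans {α β γ : List V} (h : Δ.InertStar α β) (h' : Δ.InertStar β γ) :
    Δ.InertStar α γ :=
  ⟨Relation.ReflTransGen.trans h.1 h'.1, BranchingBisimilar.trans h.2 h'.2⟩

theorem InertStar.refl (α : List V) : Δ.InertStar α α :=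
  ⟨Relation.ReflTransGen.refl, BranchingBisimilar.refl α⟩

theorem InertStar.single {α β : List V} (h : Δ.Step α none β) (h' : Δ.Beq α β) :
    Δ.InertStar α β :=
  ⟨Relation.ReflTransGen.single h, h'⟩

end Words

/-! ### The branching norm and its relation to the relative norm. -/

section Norm

/-- `BoundedNorm α k`: there is a path from `α` to the empty process in which at most `k` steps
are not inert. -/
inductive BoundedNorm (Δ : BPA V L) : List V → ℕ → Prop
  | nil : BoundedNorm Δ [] 0
  | inert {s s' : List V} {k : ℕ} (h : Δ.Step s none s') (hb : Δ.Beq s s')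
      (hp : BoundedNorm Δ s' k) : BoundedNorm Δ s k
  | step {s s' : List V} {l : Option L} {k : ℕ} (h : Δ.Step s l s')
      (hp : BoundedNorm Δ s' k) : BoundedNorm Δ s (k + 1)

theorem BoundedNorm.of_inert {s t : List V} {k : ℕ}
    (h : Relation.ReflTransGen (fun a b => Δ.Step a none b ∧ BranchingBisimilar Δ.Step a b) s t)
    (ht : Δ.BoundedNorm t k) : Δ.BoundedNorm s k := by
  induction h using Relation.ReflTransGen.head_induction_on with
  | refl => exact ht
  | head hab _ ih => exact .inert hab.1 hab.2 ih

theorem IsNormed.exists_boundedNorm (hΔ : Δ.IsNormed) (α : List V) :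
    ∃ k, Δ.BoundedNorm α k := by
  induction hΔ.reaches_nil α using Relation.ReflTransGen.head_induction_on with
  | refl => exact ⟨0, .nil⟩
  | head hab _ ih =>
    obtain ⟨k, hk⟩ := ih
    obtain ⟨l, hl⟩ := hab
    exact ⟨k + 1, .step hl hk⟩

/-- The empty process has no transitions, so it can only answer by standing still; hence every step
on a path from `t` to it is inert. -/
theorem IsNormed.boundedNorm_zero_of_beq_nil (hΔ : Δ.IsNormed) {t : List V}
    (h : Δ.Beq t []) : Δ.BoundedNorm t 0 := by
  induction hΔ.reaches_nil t using Relation.ReflTransGen.head_induction_on with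
  | refl => exact .nil
  | head hab _ ih =>
    obtain ⟨l, hl⟩ := hab
    rcases BranchingBisimilar.transfer h hl with ⟨rfl, h1⟩ | ⟨t'', t', h1, h2, -, -⟩
    · exact .inert hl (BranchingBisimilar.trans h (BranchingBisimilar.symm h1)) (ih h1)
    · exfalso
      rcases Relation.ReflTransGen.cases_head h1 with rfl | ⟨c, hc, -⟩
      · cases h2
      · cases hc

theorem BoundedNorm.congr (hΔ : Δ.IsNormed) {s : List V} {k : ℕ} (h : Δ.BoundedNorm s k) :
    ∀ t, Δ.Beq s t → ∃ k' ≤ k, Δ.BoundedNorm t k' := by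
  induction h with
  | nil =>
    intro t ht
    exact ⟨0, le_rfl, hΔ.boundedNorm_zero_of_beq_nil (BranchingBisimilar.symm ht)⟩
  | inert h hb _ ih =>
    intro t ht
    exact ih t (BranchingBisimilar.trans (BranchingBisimilar.symm hb) ht)
  | @step s s' l k h _ ih =>
    intro t ht
    rcases BranchingBisimilar.transfer ht h with ⟨rfl, h1⟩ | ⟨t'', t', h1, h2, h3, h4⟩
    · obtain ⟨k', hk, hk'⟩ := ih t h1
      exact ⟨k', by omega, hk'⟩
    · obtain ⟨k', hk, hk'⟩ := ih t' h4
      exact ⟨k' + 1, by omega, .of_inert (BranchingBisimilar.inert_of_tauStar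
        (BranchingBisimilar.trans (BranchingBisimilar.symm ht) h3) h1) (.step h2 hk')⟩

/-- A path that empties `δ ++ γ` must pass through `γ`. If the rest of the path has the same budget,
none was spent before, and the first part is inert. -/
theorem BoundedNorm.split {δ γ : List V} {k : ℕ} (h : Δ.BoundedNorm (δ ++ γ) k) :
    ∃ k' ≤ k, Δ.BoundedNorm γ k' ∧ (k' = k → Δ.InertStar (δ ++ γ) γ) := by
  suffices ∀ s, Δ.BoundedNorm s k → ∀ δ, s = δ ++ γ →
      ∃ k' ≤ k, Δ.BoundedNorm γ k' ∧ (k' = k → Δ.InertStar (δ ++ γ) γ) from this _ h δ rfl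
  clear h δ
  intro s h
  induction h with
  | nil =>
    intro δ hδ
    obtain ⟨rfl, rfl⟩ := List.append_eq_nil_iff.1 hδ.symm
    exact ⟨0, le_rfl, .nil, fun _ => .refl _⟩
  | inert h hb hp ih =>
    rintro (_ | ⟨X, δ⟩) rfl
    · exact ⟨_, le_rfl, .inert h hb hp, fun _ => .refl _⟩
    · have h0 := h
      cases h with
      | @intro _ _ ρ hr _ =>
        obtain ⟨k', hk, h1, h2⟩ := ih (ρ ++ δ) (by simp)
        refine ⟨k', hk, h1, fun e => (InertStar.single h0 hb).trans ?_⟩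
        simpa using h2 e
  | step h hp ih =>
    rintro (_ | ⟨X, δ⟩) rfl
    · exact ⟨_, le_rfl, .step h hp, fun _ => .refl _⟩
    · cases h with
      | @intro _ _ ρ hr _ =>
        obtain ⟨k', hk, h1, -⟩ := ih (ρ ++ δ) (by simp)
        exact ⟨k', by omega, h1, fun e => by omega⟩

/-- The branching norm: the least number of steps, inert ones not counted, that lead to the empty
process. -/
noncomputable def branchingNorm (Δ : BPA V L) (α : List V) : ℕ := sInf {k | Δ.BoundedNorm α k}

theorem IsNormed.boundedNorm_branchingNorm (hΔ : Δ.IsNormed) (α : List V) :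
    Δ.BoundedNorm α (Δ.branchingNorm α) :=
  Nat.sInf_mem (s := {k | Δ.BoundedNorm α k}) (hΔ.exists_boundedNorm α)

theorem BoundedNorm.branchingNorm_le {α : List V} {k : ℕ} (h : Δ.BoundedNorm α k) :
    Δ.branchingNorm α ≤ k :=
  Nat.sInf_le h

theorem IsNormed.branchingNorm_le_of_beq (hΔ : Δ.IsNormed) {s t : List V} (h : Δ.Beq s t) :
    Δ.branchingNorm t ≤ Δ.branchingNorm s := by
  obtain ⟨k', hk, h'⟩ := (hΔ.boundedNorm_branchingNorm s).congr hΔ t h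
  exact h'.branchingNorm_le.trans hk

theorem IsNormed.branchingNorm_le_append (hΔ : Δ.IsNormed) (δ γ : List V) :
    Δ.branchingNorm γ ≤ Δ.branchingNorm (δ ++ γ) := by
  obtain ⟨k', hk, h', -⟩ := (hΔ.boundedNorm_branchingNorm (δ ++ γ)).split
  exact h'.branchingNorm_le.trans hk

theorem IsNormed.inertStar_of_branchingNorm_le (hΔ : Δ.IsNormed) {δ γ : List V}
    (h : Δ.branchingNorm (δ ++ γ) ≤ Δ.branchingNorm γ) : Δ.InertStar (δ ++ γ) γ := by
  obtain ⟨k', hk, h', h2⟩ := (hΔ.boundedNorm_branchingNorm (δ ++ γ)).split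
  exact h2 (le_antisymm hk (h.trans h'.branchingNorm_le))

theorem IsNormed.inertStar_of_beq (hΔ : Δ.IsNormed) {δ γ : List V} (h : Δ.Beq (δ ++ γ) γ) :
    Δ.InertStar (δ ++ γ) γ :=
  hΔ.inertStar_of_branchingNorm_le (hΔ.branchingNorm_le_of_beq (BranchingBisimilar.symm h))

theorem IsNormed.exists_normPath (hΔ : Δ.IsNormed) (δ γ : List V) : ∃ k, Δ.NormPath γ δ k := by
  induction hΔ.reaches_nil δ using Relation.ReflTransGen.head_induction_on with
  | refl => exact ⟨0, .zero (.refl _)⟩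
  | @head a c hab _ ih =>
    obtain ⟨k, hk⟩ := ih
    obtain ⟨l, hl⟩ := hab
    have hs : Δ.Step (a ++ γ) l (c ++ γ) := by
      cases hl with
      | intro h β => simpa using Step.intro h (β ++ γ)
    by_cases hj : Δ.Jump (a ++ γ) (c ++ γ)
    · exact ⟨k + 1, .succ (.refl _) hj hk⟩
    · rcases l with _ | l
      · have hi : Δ.InertStar (a ++ γ) (c ++ γ) :=
          .single hs (by_contra fun h => hj (Or.inr ⟨hs, h⟩))
        cases hk with
        | zero h => exact ⟨0, .zero (hi.trans h)⟩
        | succ h hj hp => exact ⟨_, .succ (hi.trans h) hj hp⟩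
      · exact absurd (Or.inl ⟨l, hs⟩) hj

/-- The infimum of the empty set is also `0`; normedness excludes that case. -/
theorem IsNormed.relNorm_pos_iff (hΔ : Δ.IsNormed) {δ γ : List V} :
    0 < Δ.relNorm δ γ ↔ ¬ Δ.Beq (δ ++ γ) γ := by
  rw [Nat.pos_iff_ne_zero, not_iff_not, relNorm, Nat.sInf_eq_zero]
  constructor
  · rintro (h | h)
    · cases h with
      | zero h => exact h.2
    · obtain ⟨k, hk⟩ := hΔ.exists_normPath δ γ
      exact absurd hk (Set.eq_empty_iff_forall_notMem.1 h k)
  · exact fun h => Or.inl (.zero (hΔ.inertStar_of_beq h))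

end Norm

/-! ### Redundant sets determine behaviour on top of a stack. -/

section Redundant

theorem IsNormed.beq_append_self_iff (hΔ : Δ.IsNormed) {α γ : List V} :
    Δ.Beq (α ++ γ) γ ↔ ∀ X ∈ α, X ∈ Δ.Rd γ := by
  induction α with
  | nil => exact ⟨fun _ _ h => absurd h List.not_mem_nil, fun _ => BranchingBisimilar.refl γ⟩
  | cons X α ih =>
    have hX : Δ.Beq (α ++ γ) γ → (Δ.Beq (X :: α ++ γ) γ ↔ X ∈ Δ.Rd γ) := fun h =>
      have h1 : Δ.Beq (X :: α ++ γ) (X :: γ) := Beq.append_left h [X]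
      ⟨fun h2 => BranchingBisimilar.trans (BranchingBisimilar.symm h1) h2,
        fun h2 => BranchingBisimilar.trans h1 h2⟩
    rw [List.forall_mem_cons, ← ih]
    constructor
    · intro h
      have h1 : Δ.Beq (α ++ γ) γ :=
        (hΔ.inertStar_of_branchingNorm_le ((hΔ.branchingNorm_le_append [X] (α ++ γ)).trans
          (hΔ.branchingNorm_le_of_beq (BranchingBisimilar.symm h)))).2
      exact ⟨(hX h1).1 h, h1⟩
    · exact fun h => (hX h.2).2 h.1

theorem IsNormed.rd_subset_V0 (hΔ : Δ.IsNormed) (α : List V) : Δ.Rd α ⊆ Δ.V0 := by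
  intro X hX
  exact tauStar_nil_of_append (hΔ.inertStar_of_beq (δ := [X]) hX).1

/-- An inert path never uncovers `γ`, as it would then visit a process bisimilar to `γ`. So it acts
on the prefix only and can be replayed over `γ'`. -/
theorem exists_append_of_tauStar {β γ s : List V} (h : TauStar Δ.Step (β ++ γ) s)
    (hb : Δ.Beq (β ++ γ) s) (hγ : ¬ Δ.Beq (β ++ γ) γ) (γ' : List V) :
    ∃ X δ, s = X :: δ ++ γ ∧ TauStar Δ.Step (β ++ γ') (X :: δ ++ γ') := by
  suffices ∀ t, Relation.ReflTransGen
      (fun a b => Δ.Step a none b ∧ BranchingBisimilar Δ.Step a b) t s →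
      ∀ β, t = β ++ γ → ¬ Δ.Beq (β ++ γ) γ →
      ∃ X δ, s = X :: δ ++ γ ∧ TauStar Δ.Step (β ++ γ') (X :: δ ++ γ') from
    this _ (BranchingBisimilar.inert_of_tauStar hb h) β rfl hγ
  clear h hb hγ β
  intro t h
  induction h using Relation.ReflTransGen.head_induction_on with
  | refl =>
    rintro (_ | ⟨X, β⟩) hβ hγ
    · exact absurd (BranchingBisimilar.refl _) hγ
    · exact ⟨X, β, hβ, Relation.ReflTransGen.refl⟩
  | head hab _ ih =>
    rintro (_ | ⟨X, β⟩) rfl hγ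
    · exact absurd (BranchingBisimilar.refl _) hγ
    · obtain ⟨hs, hb⟩ := hab
      cases hs with
      | @intro _ _ ρ hr _ =>
        have e : ρ ++ (β.append γ) = (ρ ++ β) ++ γ := by simp
        rw [e] at hb
        obtain ⟨Y, δ, h1, h2⟩ := ih (ρ ++ β) e
          fun h => hγ (BranchingBisimilar.trans hb h)
        refine ⟨Y, δ, h1, Relation.ReflTransGen.head (Step.intro hr (β ++ γ')) ?_⟩
        rw [← List.append_assoc]
        exact h2

/-- Bisimilarity of `αγ` and `βγ` depends on `γ` only through its redundant set. -/
theorem IsNormed.beq_append_of_rd_eq (hΔ : Δ.IsNormed) {γ γ' : List V}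
    (hR : Δ.Rd γ = Δ.Rd γ') {α β : List V} (h : Δ.Beq (α ++ γ) (β ++ γ)) :
    Δ.Beq (α ++ γ') (β ++ γ') := by
  have hself : ∀ α, Δ.Beq (α ++ γ) γ → Δ.Beq (α ++ γ') γ' := fun α hα => by
    rw [hΔ.beq_append_self_iff, ← hR]
    exact hΔ.beq_append_self_iff.1 hα
  refine ⟨fun s t => Δ.Beq s t ∨ ∃ α β, Δ.Beq (α ++ γ) (β ++ γ) ∧ s = α ++ γ' ∧ t = β ++ γ',
    ⟨?_, ?_⟩, Or.inr ⟨α, β, h, rfl, rfl⟩⟩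
  · rintro s t (h | ⟨α, β, h, rfl, rfl⟩)
    · exact Or.inl (BranchingBisimilar.symm h)
    · exact Or.inr ⟨β, α, BranchingBisimilar.symm h, rfl, rfl⟩
  · have inherit : ∀ (s t : List V) (l : Option L) (s' : List V), Δ.Beq s t → Δ.Step s l s' →
        (l = none ∧ (Δ.Beq s' t ∨
          ∃ α β, Δ.Beq (α ++ γ) (β ++ γ) ∧ s' = α ++ γ' ∧ t = β ++ γ')) ∨
        ∃ t'' t', TauStar Δ.Step t t'' ∧ Δ.Step t'' l t' ∧
          (Δ.Beq s t'' ∨ ∃ α β, Δ.Beq (α ++ γ) (β ++ γ) ∧ s = α ++ γ' ∧ t'' = β ++ γ') ∧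
          (Δ.Beq s' t' ∨ ∃ α β, Δ.Beq (α ++ γ) (β ++ γ) ∧ s' = α ++ γ' ∧ t' = β ++ γ') := by
      intro s t l s' h hs
      rcases BranchingBisimilar.transfer h hs with ⟨hl, h1⟩ | ⟨t'', t', h1, h2, h3, h4⟩
      · exact Or.inl ⟨hl, Or.inl h1⟩
      · exact Or.inr ⟨t'', t', h1, h2, Or.inl h3, Or.inl h4⟩
    rintro s t (h | ⟨α, β, h, rfl, rfl⟩) l s' hs
    · exact inherit s t l s' h hs
    · by_cases hα : Δ.Beq (α ++ γ) γ
      · refine inherit _ _ l s' ?_ hs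
        exact BranchingBisimilar.trans (hself α hα) (BranchingBisimilar.symm (hself β
          (BranchingBisimilar.trans (BranchingBisimilar.symm h) hα)))
      · rcases α with _ | ⟨X, α⟩
        · exact absurd (BranchingBisimilar.refl _) hα
        cases hs with
        | @intro _ _ ρ hr _ =>
          have hs : Δ.Step (X :: α ++ γ) l ((ρ ++ α) ++ γ) := by
            simpa using Step.intro hr (α ++ γ)
          rcases BranchingBisimilar.transfer h hs with ⟨hl, h1⟩ | ⟨t'', t', h1, h2, h3, h4⟩
          · exact Or.inl ⟨hl, Or.inr ⟨ρ ++ α, β, h1, by simp, rfl⟩⟩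
          · have hβ := BranchingBisimilar.trans (BranchingBisimilar.symm h) h3
            obtain ⟨Y, δ, rfl, h5⟩ := exists_append_of_tauStar h1 hβ
              (fun h' => hα (BranchingBisimilar.trans h h')) γ'
            cases h2 with
            | @intro _ _ ρ' hr' _ =>
              exact Or.inr ⟨_, _, h5, Step.intro hr' (δ ++ γ'),
                Or.inr ⟨X :: α, Y :: δ, h3, rfl, rfl⟩,
                Or.inr ⟨ρ ++ α, ρ' ++ δ, by simpa [Beq] using h4, by simp, by simp⟩⟩

theorem IsNormed.rd_append_congr (hΔ : Δ.IsNormed) {γ γ' : List V} (hR : Δ.Rd γ = Δ.Rd γ')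
    (δ : List V) : Δ.Rd (δ ++ γ) = Δ.Rd (δ ++ γ') := by
  ext X
  exact ⟨fun h => hΔ.beq_append_of_rd_eq (α := X :: δ) hR h,
    fun h => hΔ.beq_append_of_rd_eq (α := X :: δ) hR.symm h⟩

theorem IsNormed.rd_mem_nodes (hΔ : Δ.IsNormed) (X : V) (α : List V) :
    (X, Δ.Rd α) ∈ Δ.nodes :=
  ⟨hΔ.rd_subset_V0 α, α, rfl⟩

end Redundant

end BPA

namespace BPA

variable {V : Type*} {L : Type*} {Δ : BPA V L}

/-! ### Regularity as finiteness of the number of classes. -/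

section Regular

/-- The processes reachable from `α` fall into finitely many bisimilarity classes. -/
def FinitelyManyClasses (Δ : BPA V L) (α : List V) : Prop :=
  ∃ F : Set (List V), F.Finite ∧ ∀ s, Δ.Reaches α s → ∃ f ∈ F, Δ.Beq s f

theorem IsRegular.finitelyManyClasses {α : List V} (h : Δ.IsRegular α) :
    Δ.FinitelyManyClasses α := by
  obtain ⟨W, Θ, γ, hfin, hb⟩ := h
  classical
  let P : List W → List V → Prop := fun t s =>
    BranchingBisimilar (SumTrans Δ.Step Θ.Step) (Sum.inl s) (Sum.inr t)
  let f : List W → List V := fun t => if h : ∃ s, P t s then h.choose else []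
  refine ⟨f '' {β | Θ.Reaches γ β}, hfin.image f, fun s hs => ?_⟩
  have hs' : Relation.ReflTransGen (fun a b => ∃ l, SumTrans Δ.Step Θ.Step a l b)
      (Sum.inl α) (Sum.inl s) :=
    Relation.ReflTransGen.lift (r := fun a b => ∃ l, Δ.Step a l b)
      (p := fun a b => ∃ l, SumTrans Δ.Step Θ.Step a l b) Sum.inl
      (fun _ _ ⟨l, hl⟩ => ⟨l, SumTrans.left hl⟩) _ _ hs
  obtain ⟨x, hx, hsx⟩ := hb.exists_reach hs'
  obtain ⟨t, rfl, ht⟩ := SumTrans.reach_inr hx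
  have hex : ∃ s, P t s := ⟨s, hsx⟩
  refine ⟨f t, ⟨t, ht, rfl⟩, ?_⟩
  have hft : P t (f t) := by
    simp only [f, dif_pos hex]
    exact hex.choose_spec
  exact BranchingBisimilar.of_inl (hsx.trans hft.symm)

/-- The quotient of the reachable part of `Δ` by bisimilarity, where the classes are represented
by the words `e c`. Every state is a word of length one. -/
def quotientSystem (Δ : BPA V L) (α : List V) {n : ℕ} (e : Fin n → List V) : BPA (Fin n) L where
  finite_vars := inferInstance
  actions := Δ.actions
  finite_actions := Δ.finite_actions
  rules := {r | ∃ c', r.2.2 = [c'] ∧ ∃ s s', Δ.Reaches α s ∧ Δ.Beq s (e r.1) ∧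
    Δ.Beq s' (e c') ∧ Δ.Step s r.2.1 s'}
  finite_rules := by
    refine (Set.finite_univ (α := Fin n)).prod (Δ.finite_actions.prod
      (Set.finite_range fun c : Fin n => [c])) |>.subset ?_
    rintro ⟨c, l, ρ⟩ ⟨c', h, s, s', -, -, -, hst⟩
    refine ⟨trivial, ?_, c', h.symm⟩
    cases hst with
    | intro h β => exact Δ.action_mem h
  action_mem := by
    rintro c l ρ ⟨c', h, s, s', -, -, -, hst⟩
    cases hst with
    | intro h β => exact Δ.action_mem h

theorem quotientSystem_step {α : List V} {n : ℕ} {e : Fin n → List V} {c : Fin n}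
    {l : Option L} {t : List (Fin n)} (h : (Δ.quotientSystem α e).Step [c] l t) :
    ∃ c', t = [c'] ∧ ∃ s s', Δ.Reaches α s ∧ Δ.Beq s (e c) ∧ Δ.Beq s' (e c') ∧
      Δ.Step s l s' := by
  cases h with
  | intro h β =>
    obtain ⟨c', h1, h2⟩ := h
    exact ⟨c', by simpa using h1, h2⟩

theorem FinitelyManyClasses.isRegular {α : List V} (h : Δ.FinitelyManyClasses α) :
    Δ.IsRegular α := by
  obtain ⟨F, hF, hcl⟩ := h
  obtain ⟨n, e, rfl⟩ : ∃ (n : ℕ) (e : Fin n → List V), Set.range e = F := by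
    obtain ⟨n, e, he⟩ := hF.fin_param
    exact ⟨n, e, he.2⟩
  simp only [Set.exists_range_iff] at hcl
  obtain ⟨c0, hc0⟩ := hcl α Relation.ReflTransGen.refl
  refine ⟨Fin n, Δ.quotientSystem α e, [c0], ?_, ?_⟩
  · refine (Set.finite_range fun c : Fin n => [c]).subset ?_
    intro t ht
    induction (show Relation.ReflTransGen _ _ _ from ht) with
    | refl => exact ⟨c0, rfl⟩
    | tail hab hbc ih =>
      obtain ⟨c, rfl⟩ := ih hab
      obtain ⟨l, hl⟩ := hbc
      obtain ⟨c', rfl, -⟩ := quotientSystem_step hl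
      exact ⟨c', rfl⟩
  · let P : List V → List (Fin n) → Prop := fun s t =>
      ∃ c, t = [c] ∧ Δ.Reaches α s ∧ Δ.Beq s (e c)
    refine ⟨fun x y => (∃ s t, x = Sum.inl s ∧ y = Sum.inr t ∧ P s t) ∨
      ∃ s t, x = Sum.inr t ∧ y = Sum.inl s ∧ P s t, ⟨?_, ?_⟩,
      Or.inl ⟨α, [c0], rfl, rfl, c0, rfl, Relation.ReflTransGen.refl, hc0⟩⟩
    · rintro x y (⟨s, t, rfl, rfl, h⟩ | ⟨s, t, rfl, rfl, h⟩)
      · exact Or.inr ⟨s, t, rfl, rfl, h⟩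
      · exact Or.inl ⟨s, t, rfl, rfl, h⟩
    · rintro x y (⟨s, t, rfl, rfl, c, rfl, hr, hc⟩ | ⟨s, t, rfl, rfl, c, rfl, hr, hc⟩) l x' hx
      · cases hx with
        | @left _ s' _ hs =>
          have hr' : Δ.Reaches α s' := Relation.ReflTransGen.tail hr ⟨l, hs⟩
          obtain ⟨c', hc'⟩ := hcl s' hr'
          have hm : (c, l, [c']) ∈ (Δ.quotientSystem α e).rules :=
            ⟨c', rfl, s, s', hr, hc, hc', hs⟩
          exact Or.inr ⟨Sum.inr [c], Sum.inr [c'], Relation.ReflTransGen.refl,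
            SumTrans.right (Step.intro hm []), Or.inl ⟨s, [c], rfl, rfl, c, rfl, hr, hc⟩,
            Or.inl ⟨s', [c'], rfl, rfl, c', rfl, hr', hc'⟩⟩
      · cases hx with
        | right hs =>
          obtain ⟨c', rfl, s0, s0', hr0, h0, h0', hs0⟩ := quotientSystem_step hs
          -- A move of the quotient stems from some representative `s0` of the class; `s` answers it
          -- because it is bisimilar to `s0`.
          have h1 : Δ.Beq s0 s := BranchingBisimilar.trans h0 (BranchingBisimilar.symm hc)
          rcases BranchingBisimilar.transfer h1 hs0 with ⟨hl, h2⟩ | ⟨s2, s3, h2, h3, h4, h5⟩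
          · exact Or.inl ⟨hl, Or.inr ⟨s, [c'], rfl, rfl, c', rfl, hr,
              BranchingBisimilar.trans (BranchingBisimilar.symm h2) h0'⟩⟩
          · have hr2 : Δ.Reaches α s2 := Relation.ReflTransGen.trans hr
              (Relation.ReflTransGen.mono (fun _ _ h => ⟨_, h⟩) _ _ h2)
            refine Or.inr ⟨Sum.inl s2, Sum.inl s3,
              Relation.ReflTransGen.lift (r := fun a b => Δ.Step a none b)
                (p := fun a b => SumTrans Δ.Step (Δ.quotientSystem α e).Step a none b) Sum.inl
                (fun _ _ h => SumTrans.left h) _ _ h2, SumTrans.left h3,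
              Or.inr ⟨s2, [c], rfl, rfl, c, rfl, hr2,
                BranchingBisimilar.trans (BranchingBisimilar.symm h4) h0⟩,
              Or.inr ⟨s3, [c'], rfl, rfl, c', rfl, Relation.ReflTransGen.tail hr2 ⟨l, h3⟩,
                BranchingBisimilar.trans (BranchingBisimilar.symm h5) h0'⟩⟩

theorem isRegular_iff {α : List V} : Δ.IsRegular α ↔ Δ.FinitelyManyClasses α :=
  ⟨IsRegular.finitelyManyClasses, FinitelyManyClasses.isRegular⟩

end Regular

end BPA

namespace BPA

variable {V : Type*} {L : Type*} {Δ : BPA V L}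

/-! ### A witness path produces stacks of unbounded norm. -/

section Pumping

theorem IsNormed.exists_of_edge (hΔ : Δ.IsNormed) {p q : V × Set V} (h : Δ.Edge p q)
    {w : List V} (hw : Δ.Rd w = p.2) :
    ∃ w', Δ.Rd w' = q.2 ∧ Δ.Reaches (p.1 :: w) (q.1 :: w') ∧
      Δ.branchingNorm w + Δ.weight p q ≤ Δ.branchingNorm w' := by
  have key : ∀ δ γ, Δ.EdgeVia p q δ γ → Δ.Rd (δ ++ w) = q.2 ∧
      Δ.Reaches (p.1 :: w) (q.1 :: (δ ++ w)) := by
    rintro δ γ ⟨⟨l, σ, hr⟩, h1, h2⟩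
    refine ⟨(hΔ.rd_append_congr (hw.trans h1.symm) δ).trans h2,
      Relation.ReflTransGen.head ⟨l, Step.intro hr w⟩ ?_⟩
    rw [List.append_assoc]
    exact hΔ.reaches_append σ (q.1 :: (δ ++ w))
  by_cases hpos : ∃ δ γ, Δ.EdgeVia p q δ γ ∧ 0 < Δ.relNorm δ γ
  · rw [weight, if_pos hpos]
    -- The word that makes the weight positive is used. An unchanged norm would make it redundant
    -- over `w`, hence over `γ`.
    obtain ⟨δ, γ, hvia, hn⟩ := hpos
    refine ⟨δ ++ w, (key δ γ hvia).1, (key δ γ hvia).2, ?_⟩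
    by_contra hlt
    have h1 := (hΔ.inertStar_of_branchingNorm_le (δ := δ) (γ := w) (by omega)).2
    exact hΔ.relNorm_pos_iff.1 hn
      (hΔ.beq_append_of_rd_eq (β := []) (hw.trans hvia.2.1.symm) h1)
  · rw [weight, if_neg hpos]
    obtain ⟨-, -, δ, γ, hvia⟩ := h
    exact ⟨δ ++ w, (key δ γ hvia).1, (key δ γ hvia).2, hΔ.branchingNorm_le_append δ w⟩

theorem IsNormed.exists_of_path (hΔ : Δ.IsNormed) {p : ℕ → V × Set V} {i k : ℕ} (hik : i ≤ k)
    (hp : ∀ j, i ≤ j → j < k → Δ.Edge (p j) (p (j + 1))) {w : List V} (hw : Δ.Rd w = (p i).2) :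
    ∃ w', Δ.Rd w' = (p k).2 ∧ Δ.Reaches ((p i).1 :: w) ((p k).1 :: w') ∧
      Δ.branchingNorm w + ∑ j ∈ Finset.Ico i k, Δ.weight (p j) (p (j + 1)) ≤
        Δ.branchingNorm w' := by
  induction k, hik using Nat.le_induction with
  | base => exact ⟨w, hw, Relation.ReflTransGen.refl, by simp⟩
  | succ k hik ih =>
    obtain ⟨w1, h1, h2, h3⟩ := ih fun j hj hj' => hp j hj (by omega)
    obtain ⟨w2, h4, h5, h6⟩ := hΔ.exists_of_edge (hp k hik (by omega)) h1
    refine ⟨w2, h4, Relation.ReflTransGen.trans h2 h5, ?_⟩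
    rw [Finset.sum_Ico_succ_top hik]
    omega

theorem FinitelyManyClasses.exists_norm_bound (hΔ : Δ.IsNormed) {α : List V}
    (h : Δ.FinitelyManyClasses α) : ∃ N, ∀ s, Δ.Reaches α s → Δ.branchingNorm s ≤ N := by
  obtain ⟨F, hF, hcl⟩ := h
  obtain ⟨N, hN⟩ := (hF.image Δ.branchingNorm).bddAbove
  refine ⟨N, fun s hs => ?_⟩
  obtain ⟨f, hf, hsf⟩ := hcl s hs
  exact (hΔ.branchingNorm_le_of_beq (BranchingBisimilar.symm hsf)).trans (hN ⟨f, hf, rfl⟩)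

theorem HasWitnessPath.not_finitelyManyClasses (hΔ : Δ.IsNormed) {X : V} {γ α : List V}
    (h : Δ.HasWitnessPath X γ) (hα : Δ.Reaches α (X :: γ)) : ¬ Δ.FinitelyManyClasses α := by
  intro hfin
  obtain ⟨N, hN⟩ := hfin.exists_norm_bound hΔ
  obtain ⟨k, p, hp0, hedge, i, hik, hpi, hsum⟩ := h
  have hX : X = (p 0).1 := by rw [hp0]
  subst hX
  obtain ⟨w0, h1, h2, -⟩ := hΔ.exists_of_path (Nat.zero_le i)
    (fun j _ hj => hedge j (hj.trans hik)) (w := γ) (by rw [hp0])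
  have pump : ∀ n : ℕ, ∃ w, Δ.Rd w = (p i).2 ∧ Δ.Reaches α ((p i).1 :: w) ∧
      n ≤ Δ.branchingNorm w := by
    intro n
    induction n with
    | zero => exact ⟨w0, h1, Relation.ReflTransGen.trans hα h2, Nat.zero_le _⟩
    | succ n ih =>
      obtain ⟨w, h3, h4, h5⟩ := ih
      obtain ⟨w', h6, h7, h8⟩ := hΔ.exists_of_path hik.le (fun j _ hj => hedge j hj) h3
      rw [← hpi] at h6 h7
      exact ⟨w', h6, Relation.ReflTransGen.trans h4 h7, by omega⟩
  obtain ⟨w, -, h4, h5⟩ := pump (N + 1)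
  have := hN _ h4
  have := hΔ.branchingNorm_le_append [(p i).1] w
  simp only [List.singleton_append] at this
  omega

end Pumping

/-! ### Without witness paths, stacks stay bounded up to bisimilarity. -/

section Bounded

theorem exists_path_of_reflTransGen {A : Type*} {r : A → A → Prop} {a b : A}
    (h : Relation.ReflTransGen r a b) :
    ∃ (n : ℕ) (f : ℕ → A), f 0 = a ∧ f n = b ∧ ∀ j < n, r (f j) (f (j + 1)) := by
  induction h with
  | refl => exact ⟨0, fun _ => a, rfl, rfl, by simp⟩
  | @tail b c _ hbc ih =>
    obtain ⟨n, f, h0, hn, hf⟩ := ih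
    refine ⟨n + 1, fun j => if j ≤ n then f j else c, by simp [h0], by simp, fun j hj => ?_⟩
    rcases Nat.lt_succ_iff_lt_or_eq.1 hj with hj' | rfl
    · simpa [hj'.le, Nat.succ_le_of_lt hj'] using hf j hj'
    · simpa [hn] using hbc

theorem hasWitnessPath_of_cycle {X : V} {γ : List V} {p q : V × Set V}
    (h1 : Relation.ReflTransGen Δ.Edge (X, Δ.Rd γ) p) (h2 : Δ.Edge p q)
    (h3 : 0 < Δ.weight p q) (h4 : Relation.ReflTransGen Δ.Edge q p) : Δ.HasWitnessPath X γ := by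
  obtain ⟨m, f, hf0, hfm, hf⟩ := exists_path_of_reflTransGen h1
  obtain ⟨n, g, hg0, hgn, hg⟩ := exists_path_of_reflTransGen h4
  -- Positions `m` and `m + 1` hold `p` and `q`; the shift by `m + 1` starts `g` right after the
  -- positive edge.
  set h : ℕ → V × Set V := fun j => if j ≤ m then f j else g (j - (m + 1)) with hh
  have hm : h m = p := by simp [hh, hfm]
  have hm1 : h (m + 1) = q := by simp [hh, hg0]
  refine ⟨m + 1 + n, h, by simp [hh, hf0], fun j hj => ?_, m, by omega, ?_, ?_⟩
  · rcases lt_trichotomy j m with hjm | rfl | hjm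
    · simpa [hh, hjm.le, Nat.succ_le_of_lt hjm] using hf j hjm
    · rwa [hm, hm1]
    · have e1 : h j = g (j - (m + 1)) := if_neg (by omega)
      have e2 : h (j + 1) = g (j - (m + 1) + 1) := by
        rw [hh]
        simp only
        rw [if_neg (by omega), show j + 1 - (m + 1) = j - (m + 1) + 1 by omega]
      rw [e1, e2]
      exact hg _ (by omega)
  · rw [hm, ← hgn, hh]
    simp only
    rw [if_neg (by omega), show m + 1 + n - (m + 1) = n by omega]
  · refine Finset.sum_pos' (fun _ _ => Nat.zero_le _) ⟨m, by simp; omega, ?_⟩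
    rwa [hm, hm1]

/-- The number of nodes reachable from a node. -/
noncomputable def reachCount (Δ : BPA V L) (p : V × Set V) : ℕ :=
  {q | Relation.ReflTransGen Δ.Edge p q}.ncard

theorem reachCount_le {p q : V × Set V} (h : Δ.Edge p q) : Δ.reachCount q ≤ Δ.reachCount p := by
  have := Δ.finite_vars
  exact Set.ncard_le_ncard (fun _ hr => Relation.ReflTransGen.head h hr) (Set.toFinite _)

theorem reachCount_lt {p q : V × Set V} (h : Δ.Edge p q)
    (h' : ¬ Relation.ReflTransGen Δ.Edge q p) : Δ.reachCount q < Δ.reachCount p := by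
  have := Δ.finite_vars
  refine Set.ncard_lt_ncard ⟨fun _ hr => Relation.ReflTransGen.head h hr, fun hsub => h' ?_⟩
    (Set.toFinite _)
  exact hsub Relation.ReflTransGen.refl

/-- `Tracked X γ Z β`: the occurrence of `Z` on top of `β` arises from that of `X` on top of `γ`
by successive applications of rules to ancestors. -/
inductive Tracked (Δ : BPA V L) (X : V) (γ : List V) : V → List V → Prop
  | base : Tracked Δ X γ X γ
  | rule {Y Z : V} {l : Option L} {σ δ β : List V} (h : Tracked Δ X γ Y β)
      (hr : (Y, l, σ ++ Z :: δ) ∈ Δ.rules) : Tracked Δ X γ Z (δ ++ β)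

theorem Tracked.tail {X Z : V} {γ β : List V} (h : Δ.Tracked X γ Z β) :
    β = γ ∨ ∃ Y β', β = Y :: β' ∧ Δ.Tracked X γ Y β' := by
  induction h with
  | base => exact Or.inl rfl
  | @rule Y Z l σ δ β h hr ih =>
    rcases δ with _ | ⟨U, δ⟩
    · exact ih
    · refine Or.inr ⟨U, δ ++ β, rfl, h.rule (l := l) (σ := σ ++ [Z]) ?_⟩
      simpa using hr

theorem reaches_cons {X : V} {γ s : List V} (h : Δ.Reaches (X :: γ) s) :
    Δ.Reaches γ s ∨ ∃ Z β, s = Z :: β ∧ Δ.Tracked X γ Z β := by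
  induction h with
  | refl => exact Or.inr ⟨X, γ, rfl, .base⟩
  | tail _ hbc ih =>
    rcases ih with ih | ⟨Z, β, rfl, ht⟩
    · exact Or.inl (Relation.ReflTransGen.tail ih hbc)
    · obtain ⟨l, hl⟩ := hbc
      cases hl with
      | @intro _ _ ρ hr _ =>
        rcases ρ with _ | ⟨U, δ⟩
        · rcases ht.tail with rfl | h
          · exact Or.inl Relation.ReflTransGen.refl
          · exact Or.inr h
        · exact Or.inr ⟨U, δ ++ β, rfl, ht.rule (l := l) (σ := []) hr⟩

theorem IsNormed.edge_of_rule (hΔ : Δ.IsNormed) {Y Z : V} {l : Option L} {σ δ : List V}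
    (hr : (Y, l, σ ++ Z :: δ) ∈ Δ.rules) (β : List V) :
    Δ.Edge (Y, Δ.Rd β) (Z, Δ.Rd (δ ++ β)) :=
  ⟨hΔ.rd_mem_nodes _ _, hΔ.rd_mem_nodes _ _, δ, β, ⟨l, σ, hr⟩, rfl, rfl⟩

theorem Tracked.reflTransGen (hΔ : Δ.IsNormed) {X Z : V} {γ β : List V}
    (h : Δ.Tracked X γ Z β) :
    Relation.ReflTransGen Δ.Edge (X, Δ.Rd γ) (Z, Δ.Rd β) := by
  induction h with
  | base => exact Relation.ReflTransGen.refl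
  | rule _ hr ih => exact ih.tail (hΔ.edge_of_rule hr _)

/-- A potential argument: each reachable node is worth `M` letters. A step that changes the stack up
to bisimilarity has a positive edge; if its source were reachable again there would be a witness
path, so the count drops and pays for the new letters. Other steps keep `θ`. -/
theorem Tracked.exists_beq (hΔ : Δ.IsNormed) {X Z : V} {γ β : List V}
    (hX : ¬ Δ.HasWitnessPath X γ) {M : ℕ} (hM : ∀ r ∈ Δ.rules, r.2.2.length ≤ M)
    (h : Δ.Tracked X γ Z β) :
    ∃ θ, Δ.Beq β (θ ++ γ) ∧
      θ.length + M * Δ.reachCount (Z, Δ.Rd β) ≤ M * Δ.reachCount (X, Δ.Rd γ) := by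
  induction h with
  | base => exact ⟨[], BranchingBisimilar.refl _, by simp⟩
  | @rule Y Z l σ δ β h hr ih =>
    obtain ⟨θ, h1, h2⟩ := ih
    have he := hΔ.edge_of_rule hr β
    by_cases hb : Δ.Beq (δ ++ β) β
    · refine ⟨θ, BranchingBisimilar.trans hb h1, le_trans ?_ h2⟩
      exact Nat.add_le_add_left (Nat.mul_le_mul_left M (reachCount_le he)) _
    · have hw : 0 < Δ.weight (Y, Δ.Rd β) (Z, Δ.Rd (δ ++ β)) := by
        rw [weight, if_pos ⟨δ, β, ⟨⟨l, σ, hr⟩, rfl, rfl⟩, hΔ.relNorm_pos_iff.2 hb⟩]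
        exact one_pos
      have hlt := reachCount_lt he
        fun hc => hX (hasWitnessPath_of_cycle (h.reflTransGen hΔ) he hw hc)
      have hδ : δ.length ≤ M := by
        have := hM _ hr
        simp only [List.length_append, List.length_cons] at this
        omega
      refine ⟨δ ++ θ, ?_, ?_⟩
      · rw [List.append_assoc]
        exact Beq.append_left h1 δ
      · have := Nat.mul_le_mul_left M (Nat.succ_le_of_lt hlt)
        rw [Nat.mul_succ] at this
        rw [List.length_append]
        omega

theorem IsNormed.finitelyManyClasses_of_forall (hΔ : Δ.IsNormed) (α : List V)
    (h : ∀ (i : ℕ) (hi : i < α.length), ¬ Δ.HasWitnessPath α[i] (α.drop (i + 1))) :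
    Δ.FinitelyManyClasses α := by
  have := Δ.finite_vars
  induction α with
  | nil =>
    refine ⟨{[]}, Set.finite_singleton _, fun s hs => ⟨[], rfl, ?_⟩⟩
    rcases Relation.ReflTransGen.cases_head hs with rfl | ⟨c, ⟨l, hl⟩, -⟩
    · exact BranchingBisimilar.refl _
    · cases hl
  | cons X γ ih =>
    obtain ⟨F, hF, hcl⟩ := ih fun i hi => h (i + 1) (Nat.succ_lt_succ hi)
    have hX : ¬ Δ.HasWitnessPath X γ := h 0 (Nat.succ_pos _)
    obtain ⟨M, hM⟩ := (Δ.finite_rules.image fun r => r.2.2.length).bddAbove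
    refine ⟨F ∪ (fun x : V × List V => x.1 :: (x.2 ++ γ)) ''
      (Set.univ ×ˢ {θ | θ.length ≤ M * Δ.reachCount (X, Δ.Rd γ)}),
      hF.union ((Set.finite_univ.prod (List.finite_length_le V _)).image _), fun s hs => ?_⟩
    rcases reaches_cons hs with hs | ⟨Z, β, rfl, ht⟩
    · obtain ⟨f, hf, hsf⟩ := hcl s hs
      exact ⟨f, Or.inl hf, hsf⟩
    · obtain ⟨θ, h1, h2⟩ := ht.exists_beq hΔ hX fun r hr => hM ⟨r, hr, rfl⟩
      exact ⟨Z :: (θ ++ γ), Or.inr ⟨(Z, θ), ⟨trivial, (Nat.le_add_right _ _).trans h2⟩, rfl⟩,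
        Beq.append_left h1 [Z]⟩

end Bounded

end BPA

theorem mainTheorem7 {V : Type*} {L : Type*} (Δ : BPA V L) (hΔ : Δ.IsNormed) (α : List V) :
    ¬ Δ.IsRegular α ↔
      ∃ (i : ℕ) (hi : i < α.length), Δ.HasWitnessPath α[i] (α.drop (i + 1)) := by
  rw [BPA.isRegular_iff]
  constructor
  · intro h
    by_contra! hcon
    exact h (hΔ.finitelyManyClasses_of_forall α hcon)
  · rintro ⟨i, hi, h⟩
    refine h.not_finitelyManyClasses hΔ ?_
    -- By normedness the letters before position `i` can be consumed, so the suffix with the witness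
    -- path is reachable.
    rw [← List.drop_eq_getElem_cons hi]
    conv_lhs => rw [← List.take_append_drop i α]
    exact hΔ.reaches_append _ _
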